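/- **Lemma.** All vector spaces are over $\mathbb{C}$. For $c\in\mathbb{C}$ consider the following differential operators in two variables $x,y$: $$J^1_c=x^2\partial_x+xy\partial_y-cx,\quad J^2_c=xy\partial_x+y^2\partial_y-cy,\quad J^3_c=y\partial_x,\quad J^4_c=\partial_x,$$ $$J^5_c=\partial_y,\quad J^6_c=x\partial_y,\quad J^7_c=x\partial_x-\tfrac c3,\quad J^8_c=y\partial_y-\tfrac c3 .$$ Let $\mathfrak D$ be the associative algebra of $2\times2$ matrices of linear operators on $\mathbb{C}[x,y]$; it contains the $2\times 2$ matrix differential operators in $x,y$ with polynomial coefficients. Regard $\mathfrak D$ as a Lie superalgebra in which diagonal matrices are even, off-diagonal matrices are odd, and $[A,B]_s=AB-(-1)^{\deg A\deg B}BA$ for homogeneous $A,B$. Put $\sigma^+=\begin{pmatrix}0&1\\0&0\end{pmatrix}$, $\sigma^-=\begin{pmatrix}0&0\\1&0\end{pmatrix}$, $\sigma_3=\operatorname{diag}(1,-1)$. For integers $0\le\Delta\le n$ let $\mathfrak s^\Delta_n\subset\mathfrak D$ be the Lie superalgebra generated by the matrix differential operators $$T^i=\operatorname{diag}(J^i_{n-\Delta},J^i_n)\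 (1\le i\le 8),\qquad J=\tfrac13\operatorname{diag}(n+2\Delta,n),$$ $$Q^-_{\alpha\beta}=x^\alpha y^\beta\,\sigma^-,\qquad Q^+_{\alpha\beta}=\Big(\prod_{k=1}^{\Delta-\alpha-\beta}(x\partial_x+y\partial_y-n+\Delta-k)\Big)\partial_x^\alpha\partial_y^\beta\,\sigma^+,$$ where $\alpha,\beta\ge0$ are integers with $\alpha+\beta\le\Delta$ (an empty product is $1$). Then: 1. For all integers $0\le\Delta\le n$, the Lie superalgebra $\mathfrak s^\Delta_n$ is finite-dimensional if and only if $\Delta\le1$. 2. For every integer $n\ge1$, $\mathfrak s^1_n$ is isomorphic, as a Lie superalgebra, to $\mathfrak{spl}(3,1)$, the Lie superalgebra of complex $(3+1)\times(3+1)$ matrices of supertrace zero. 3. For every integer $n\ge0$, the Lie algebra obtained from $\mathfrak s^0_n$ by replacing $J$ with $\sigma_3$ and the supercommutator with the ordinary commutator, that is, the Lie algebra generated by $T^1,\dots,T^8,\sigma_3,Q^-_{00},Q^+_{00}$ (for $\Delta=0$), is isomorphic to $\mathfrak{sl}_3\oplus\mathfrak{sl}_2$ (over $\mathbb C$). -/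

import Mathlib

open MvPolynomial

/- The commutator bracket on associative algebras, for the Lie algebra structure of matrices. -/
attribute [local instance] LieRing.ofAssociativeRing

set_option linter.unusedSectionVars false

noncomputable section

/-! ### Lie superalgebras over the complex numbers -/

/-- The sign `(-1) ^ (k * l)` for degrees `k, l ∈ ℤ/2`. -/
def superSign (k l : ZMod 2) : ℂ := if k = 1 ∧ l = 1 then -1 else 1

/-- A Lie superalgebra structure on a complex vector space `L`: a decomposition
`L = L₀ ⊕ L₁` and a bilinear bracket that is compatible with the grading, graded
skew-symmetric, and satisfies the graded Jacobi identity. -/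
structure LieSuperalgebra (L : Type*) [AddCommGroup L] [Module ℂ L] where
  /-- `grading 0` is the even part and `grading 1` the odd part. -/
  grading : ZMod 2 → Submodule ℂ L
  isCompl : IsCompl (grading 0) (grading 1)
  bracket : L →ₗ[ℂ] L →ₗ[ℂ] L
  bracket_mem_grading : ∀ k l : ZMod 2, ∀ x ∈ grading k, ∀ y ∈ grading l,
    bracket x y ∈ grading (k + l)
  bracket_skew : ∀ k l : ZMod 2, ∀ x ∈ grading k, ∀ y ∈ grading l,
    bracket x y = -(superSign k l • bracket y x)
  jacobi : ∀ k l m : ZMod 2, ∀ x ∈ grading k, ∀ y ∈ grading l, ∀ z ∈ grading m,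
    bracket x (bracket y z) =
      bracket (bracket x y) z + superSign k l • bracket y (bracket x z)

namespace LieSuperalgebra

variable {L L' : Type*} [AddCommGroup L] [Module ℂ L] [AddCommGroup L'] [Module ℂ L']

/-- An isomorphism of Lie superalgebras: a linear bijection that preserves the parity and the
bracket. -/
structure Iso (A : LieSuperalgebra L) (B : LieSuperalgebra L') extends L ≃ₗ[ℂ] L' where
  map_grading : ∀ k : ZMod 2, ∀ x ∈ A.grading k, toLinearEquiv x ∈ B.grading k
  map_bracket : ∀ x y : L,
    toLinearEquiv (A.bracket x y) = B.bracket (toLinearEquiv x) (toLinearEquiv y)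

/-- A Lie sub-superalgebra: a graded subspace closed under the bracket. Graded means that
the even and the odd component of each of its elements belong to it. -/
structure Sub (A : LieSuperalgebra L) extends Submodule ℂ L where
  graded : ∀ x ∈ A.grading 0, ∀ y ∈ A.grading 1, x + y ∈ toSubmodule →
    x ∈ toSubmodule ∧ y ∈ toSubmodule
  bracket_mem : ∀ x ∈ toSubmodule, ∀ y ∈ toSubmodule, A.bracket x y ∈ toSubmodule

/-- A Lie sub-superalgebra is a Lie superalgebra. -/
def Sub.toLieSuperalgebra {A : LieSuperalgebra L} (S : A.Sub) :
    LieSuperalgebra S.toSubmodule where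
  grading k := (A.grading k).comap S.toSubmodule.subtype
  isCompl := by
    constructor
    · rw [Submodule.disjoint_def]
      intro x h0 h1
      exact Subtype.ext ((Submodule.disjoint_def.1 A.isCompl.disjoint) x.1 h0 h1)
    · rw [codisjoint_iff, eq_top_iff]
      rintro ⟨z, hz⟩ -
      have hz' : z ∈ A.grading 0 ⊔ A.grading 1 := by
        rw [A.isCompl.sup_eq_top]; trivial
      obtain ⟨x, hx, y, hy, rfl⟩ := Submodule.mem_sup.1 hz'
      obtain ⟨hx', hy'⟩ := S.graded x hx y hy hz
      exact Submodule.mem_sup.2 ⟨⟨x, hx'⟩, hx, ⟨y, hy'⟩, hy, rfl⟩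
  bracket := LinearMap.mk₂ ℂ (fun x y => ⟨A.bracket x y, S.bracket_mem x x.2 y y.2⟩)
    (fun _ _ _ => Subtype.ext (by simp)) (fun _ _ _ => Subtype.ext (by simp))
    (fun _ _ _ => Subtype.ext (by simp)) (fun _ _ _ => Subtype.ext (by simp))
  bracket_mem_grading k l x hx y hy := A.bracket_mem_grading k l x hx y hy
  bracket_skew k l x hx y hy := Subtype.ext (A.bracket_skew k l x hx y hy)
  jacobi k l m x hx y hy z hz := Subtype.ext (A.jacobi k l m x hx y hy z hz)

/-- The Lie sub-superalgebra generated by a set: the intersection of all Lie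
sub-superalgebras that contain it. -/
def lieSpan (A : LieSuperalgebra L) (s : Set L) : A.Sub where
  toSubmodule := sInf {N | ∃ S : A.Sub, s ⊆ S.toSubmodule ∧ N = S.toSubmodule}
  graded x hx y hy h := by
    rw [Submodule.mem_sInf] at h
    simp only [Submodule.mem_sInf]
    constructor
    · rintro N ⟨S, hS, rfl⟩
      exact (S.graded x hx y hy (h _ ⟨S, hS, rfl⟩)).1
    · rintro N ⟨S, hS, rfl⟩
      exact (S.graded x hx y hy (h _ ⟨S, hS, rfl⟩)).2
  bracket_mem x hx y hy := by
    rw [Submodule.mem_sInf] at hx hy ⊢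
    rintro N ⟨S, hS, rfl⟩
    exact S.bracket_mem x (hx _ ⟨S, hS, rfl⟩) y (hy _ ⟨S, hS, rfl⟩)

end LieSuperalgebra

/-! ### Matrices with a parity on the index set -/

namespace SuperMatrix

variable {ι R : Type*} [Fintype ι] [DecidableEq ι] [Ring R] [Algebra ℂ R]

/-- Matrices of degree `k`: the entries `M i j` with `par i + par j ≠ k` vanish. -/
def degreePart (R : Type*) [Ring R] [Algebra ℂ R] (par : ι → ZMod 2) (k : ZMod 2) :
    Submodule ℂ (Matrix ι ι R) where
  carrier := {M | ∀ i j, par i + par j ≠ k → M i j = 0}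
  add_mem' ha hb i j h := by simp [ha i j h, hb i j h]
  zero_mem' _ _ _ := rfl
  smul_mem' c M hM i j h := by simp [hM i j h]

/-- The projection onto the matrices of degree `k`. -/
def proj (par : ι → ZMod 2) (k : ZMod 2) : Matrix ι ι R →ₗ[ℂ] Matrix ι ι R where
  toFun M := Matrix.of fun i j => if par i + par j = k then M i j else 0
  map_add' M N := by ext i j; by_cases h : par i + par j = k <;> simp [h]
  map_smul' c M := by ext i j; by_cases h : par i + par j = k <;> simp [h]

/-- The supercommutator, the bilinear extension of
`[M, N] = M N - (-1) ^ (deg M * deg N) N M` for homogeneous `M`, `N`. -/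
def superComm (par : ι → ZMod 2) : Matrix ι ι R →ₗ[ℂ] Matrix ι ι R →ₗ[ℂ] Matrix ι ι R :=
  ∑ k : ZMod 2, ∑ l : ZMod 2, LinearMap.compl₁₂
    (LinearMap.mul ℂ (Matrix ι ι R) - superSign k l • (LinearMap.mul ℂ (Matrix ι ι R)).flip)
    (proj par k) (proj par l)

theorem proj_of_mem (par : ι → ZMod 2) {k : ZMod 2} {M : Matrix ι ι R}
    (hM : M ∈ degreePart R par k) (l : ZMod 2) : proj par l M = if k = l then M else 0 := by
  ext i j
  have := hM i j
  simp only [proj, LinearMap.coe_mk, AddHom.coe_mk, Matrix.of_apply]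
  split_ifs with h1 h2 h2
  · rfl
  · exact this fun h => h2 (h.symm.trans h1)
  · exact (this fun h => h1 (h.trans h2)).symm
  · rfl

theorem superComm_of_mem (par : ι → ZMod 2) {k l : ZMod 2} {M N : Matrix ι ι R}
    (hM : M ∈ degreePart R par k) (hN : N ∈ degreePart R par l) :
    superComm par M N = M * N - superSign k l • (N * M) := by
  simp only [superComm, LinearMap.sum_apply, LinearMap.compl₁₂_apply, proj_of_mem par hM,
    proj_of_mem par hN]
  rw [Finset.sum_eq_single k, Finset.sum_eq_single l]
  · simp
  · intro b _ hb; simp [hb.symm]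
  · simp
  · intro b _ hb; simp [hb.symm]
  · simp

theorem mul_mem (par : ι → ZMod 2) {k l : ZMod 2} {M N : Matrix ι ι R}
    (hM : M ∈ degreePart R par k) (hN : N ∈ degreePart R par l) :
    M * N ∈ degreePart R par (k + l) := by
  intro i j h
  rw [Matrix.mul_apply]
  refine Finset.sum_eq_zero fun a _ => ?_
  by_cases h1 : par i + par a = k
  · by_cases h2 : par a + par j = l
    · refine absurd ?_ h
      rw [← h1, ← h2]
      generalize par i = u
      generalize par a = v
      generalize par j = w
      revert u v w; decide
    · rw [hN a j h2, mul_zero]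
  · rw [hM i a h1, zero_mul]

theorem superComm_mem (par : ι → ZMod 2) {k l : ZMod 2} {M N : Matrix ι ι R}
    (hM : M ∈ degreePart R par k) (hN : N ∈ degreePart R par l) :
    superComm par M N ∈ degreePart R par (k + l) := by
  rw [superComm_of_mem par hM hN]
  exact Submodule.sub_mem _ (mul_mem par hM hN)
    (Submodule.smul_mem _ _ (add_comm l k ▸ mul_mem par hN hM))

/-- The Lie superalgebra of all matrices over `R`, with the supercommutator. -/
def lieSuperalgebra (R : Type*) [Ring R] [Algebra ℂ R] (par : ι → ZMod 2) :
    LieSuperalgebra (Matrix ι ι R) where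
  grading := degreePart R par
  isCompl := by
    constructor
    · rw [Submodule.disjoint_def]
      intro M h0 h1
      ext i j
      by_cases h : par i + par j = 0
      · exact h1 i j (by rw [h]; decide)
      · exact h0 i j h
    · rw [codisjoint_iff, eq_top_iff]
      rintro M -
      refine Submodule.mem_sup.2 ⟨proj par 0 M, ?_, proj par 1 M, ?_, ?_⟩
      · intro i j h; simp [proj, h]
      · intro i j h; simp [proj, h]
      · ext i j
        have h2 : par i + par j = 0 ∨ par i + par j = 1 := by
          generalize par i + par j = u
          revert u; decide
        rcases h2 with h | h <;> simp [proj, h]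
  bracket := superComm par
  bracket_mem_grading k l x hx y hy := superComm_mem par hx hy
  bracket_skew k l x hx y hy := by
    rw [superComm_of_mem par hx hy, superComm_of_mem par hy hx]
    unfold superSign
    by_cases hk : k = 1 <;> by_cases hl : l = 1 <;> simp [hk, hl]
  jacobi k l m x hx y hy z hz := by
    rw [superComm_of_mem par hx (superComm_mem par hy hz), superComm_of_mem par hy hz,
      superComm_of_mem par (superComm_mem par hx hy) hz, superComm_of_mem par hx hy,
      superComm_of_mem par hy (superComm_mem par hx hz), superComm_of_mem par hx hz]
    have h2 : ∀ u : ZMod 2, u = 0 ∨ u = 1 := by decide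
    have h11 : (1 : ZMod 2) + 1 = 0 := by decide
    rcases h2 k with rfl | rfl <;> rcases h2 l with rfl | rfl <;> rcases h2 m with rfl | rfl <;>
      simp [superSign, h11] <;> noncomm_ring

/-- The supertrace `∑ (-1) ^ (par i) * M i i`. -/
def supertrace (par : ι → ZMod 2) (M : Matrix ι ι ℂ) : ℂ :=
  ∑ i, (if par i = 0 then 1 else -1) * M i i

theorem supertrace_superComm (par : ι → ZMod 2) (M N : Matrix ι ι ℂ) :
    supertrace par (superComm par M N) = 0 := by
  have h2 : ∀ u : ZMod 2, u = 0 ∨ u = 1 := by decide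
  have hu : (Finset.univ : Finset (ZMod 2)) = {0, 1} := by decide
  have h01 : ((0 : ZMod 2) = 1) = False := by simp
  have h11 : (1 : ZMod 2) + 1 = 0 := by decide
  have key : ∀ i, (superComm par M N) i i =
      ∑ j, (M i j * N j i - (if par i + par j = 0 then 1 else -1) * (N i j * M j i)) := by
    intro i
    simp only [superComm, hu, superSign]
    simp [proj, Matrix.mul_apply, Matrix.add_apply, Matrix.sub_apply]
    simp only [← Finset.sum_add_distrib, ← Finset.sum_sub_distrib]
    refine Finset.sum_congr rfl fun j _ => ?_
    rcases h2 (par i) with h | h <;> rcases h2 (par j) with h' | h' <;> simp [h, h', h11]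
  unfold supertrace
  simp only [key, Finset.mul_sum, mul_sub, Finset.sum_sub_distrib]
  rw [sub_eq_zero, Finset.sum_comm]
  refine Finset.sum_congr rfl fun i _ => Finset.sum_congr rfl fun j _ => ?_
  rcases h2 (par i) with h | h <;> rcases h2 (par j) with h' | h' <;> simp [h, h', h11] <;> ring

end SuperMatrix

/-- The parity on the index set of `(p + q) × (p + q)` matrices: the first `p` indices are
even, the last `q` are odd. -/
def blockParity (p q : ℕ) : Fin p ⊕ Fin q → ZMod 2 := Sum.elim (fun _ => 0) (fun _ => 1)

/-- The special linear Lie superalgebra `spl(p, q)`: complex `(p + q) × (p + q)` matrices of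
supertrace zero, with the supercommutator. -/
def spl (p q : ℕ) : (SuperMatrix.lieSuperalgebra ℂ (blockParity p q)).Sub where
  carrier := {M | SuperMatrix.supertrace (blockParity p q) M = 0}
  add_mem' {a b} ha hb := by
    simp only [Set.mem_ofPred_eq, SuperMatrix.supertrace, Matrix.add_apply, mul_add,
      Finset.sum_add_distrib] at *
    rw [ha, hb, add_zero]
  zero_mem' := by simp [SuperMatrix.supertrace]
  smul_mem' c M hM := by
    simp only [Set.mem_ofPred_eq, SuperMatrix.supertrace, Matrix.smul_apply, smul_eq_mul] at *
    simp only [mul_left_comm _ c]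
    rw [← Finset.mul_sum, hM, mul_zero]
  graded x hx y hy h := by
    have hy' : ∀ i, y i i = 0 := fun i => hy i i (by
      generalize blockParity p q i = u
      revert u; decide)
    have hy0 : SuperMatrix.supertrace (blockParity p q) y = 0 := by
      simp [SuperMatrix.supertrace, hy']
    refine ⟨?_, hy0⟩
    change SuperMatrix.supertrace (blockParity p q) (x + y) = 0 at h
    change SuperMatrix.supertrace (blockParity p q) x = 0
    simpa [SuperMatrix.supertrace, hy'] using h
  bracket_mem x _ y _ := SuperMatrix.supertrace_superComm _ x y

/-! ### Differential operators in two variables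

A differential operator with polynomial coefficients in `x, y` is identified with the
endomorphism of `ℂ[x, y]` it induces; this identification is injective. A `2 × 2` matrix
differential operator acts on `ℂ[x, y] ⊕ ℂ[x, y]`. -/

/-- The endomorphisms of `ℂ[x, y]`. -/
abbrev PolyEnd : Type := Module.End ℂ (MvPolynomial (Fin 2) ℂ)

namespace PolyEnd

/-- Multiplication by `x`. -/
def x : PolyEnd := LinearMap.mulLeft ℂ (X 0)

/-- Multiplication by `y`. -/
def y : PolyEnd := LinearMap.mulLeft ℂ (X 1)

/-- The partial derivative `∂/∂x`. -/
def dx : PolyEnd := (pderiv (R := ℂ) (0 : Fin 2)).toLinearMap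

/-- The partial derivative `∂/∂y`. -/
def dy : PolyEnd := (pderiv (R := ℂ) (1 : Fin 2)).toLinearMap

/-- The operators `J¹, …, J⁸` with parameter `c` (listed here as `J c 0, …, J c 7`), a basis of a
copy of `sl₃`. -/
def J (c : ℂ) : Fin 8 → PolyEnd :=
  ![x ^ 2 * dx + x * y * dy - c • x,
    x * y * dx + y ^ 2 * dy - c • y,
    y * dx,
    dx,
    dy,
    x * dy,
    x * dx - (c / 3) • 1,
    y * dy - (c / 3) • 1]

/-- The multiplication operator `q_{αβ} = x^α y^β`. -/
def q (α β : ℕ) : PolyEnd := x ^ α * y ^ β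

/-- The operator `∏_{k=1}^{Δ-α-β} (x ∂x + y ∂y - n + Δ - k) ∂x^α ∂y^β`. The factors of the
product commute. -/
def qbar (n Δ α β : ℕ) : PolyEnd :=
  ((List.range (Δ - α - β)).map fun k =>
    x * dx + y * dy - ((n : ℂ) - (Δ : ℂ) + ((k : ℂ) + 1)) • (1 : PolyEnd)).prod *
  (dx ^ α * dy ^ β)

end PolyEnd

/-- `2 × 2` matrices of operators on `ℂ[x, y]`. -/
abbrev MatOp : Type := Matrix (Fin 2) (Fin 2) PolyEnd

/-- The Lie superalgebra of `2 × 2` matrices of operators: diagonal matrices are even,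
off-diagonal ones odd. -/
def matOpSuper : LieSuperalgebra MatOp := SuperMatrix.lieSuperalgebra PolyEnd ![0, 1]

namespace Triangular

/-- `T^i = diag(J^i_{n-Δ}, J^i_n)`. -/
def T (n Δ : ℕ) (i : Fin 8) : MatOp :=
  !![PolyEnd.J ((n : ℂ) - (Δ : ℂ)) i, 0; 0, PolyEnd.J (n : ℂ) i]

/-- `J = (1/3) diag(n + 2Δ, n)`. -/
def J (n Δ : ℕ) : MatOp :=
  !![(((n : ℂ) + 2 * (Δ : ℂ)) / 3) • (1 : PolyEnd), 0; 0, ((n : ℂ) / 3) • (1 : PolyEnd)]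

/-- `Q⁻_{αβ} = q_{αβ} σ⁻`. -/
def Qminus (α β : ℕ) : MatOp := !![0, 0; PolyEnd.q α β, 0]

/-- `Q⁺_{αβ} = q̄_{αβ}(n, Δ) σ⁺`. -/
def Qplus (n Δ α β : ℕ) : MatOp := !![0, PolyEnd.qbar n Δ α β; 0, 0]

/-- `σ₃ = diag(1, -1)`. -/
def sigma3 : MatOp := !![1, 0; 0, -1]

/-- The generators `T^i`, `J`, `Q^±_{αβ}`, `0 ≤ α + β ≤ Δ`. -/
def generators (n Δ : ℕ) : Set MatOp :=
  Set.range (T n Δ) ∪ {J n Δ} ∪ {M | ∃ α β : ℕ, α + β ≤ Δ ∧ M = Qminus α β} ∪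
    {M | ∃ α β : ℕ, α + β ≤ Δ ∧ M = Qplus n Δ α β}

/-- The Lie superalgebra `s^Δ_n` generated by `T^i`, `J`, `Q^±_{αβ}`. -/
def s (n Δ : ℕ) : matOpSuper.Sub := matOpSuper.lieSpan (generators n Δ)

/-- `s^0_n` regarded as a Lie algebra with `J` replaced by `σ₃`: the Lie algebra, under the
ordinary commutator, generated by `T^i`, `σ₃`, `Q^±_{00}` for `Δ = 0`. -/
def sZeroLie (n : ℕ) : LieSubalgebra ℂ MatOp :=
  LieSubalgebra.lieSpan ℂ MatOp
    (Set.range (T n 0) ∪ {sigma3, Qminus 0 0, Qplus n 0 0 0})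

end Triangular

end

open MvPolynomial

noncomputable section

/-! View `ℂ[x, y]` as dehomogenized functions of degree `c` in `z₀, z₁, z₂`, with `z₀ = 1`, `z₁ =
x`, `z₂ = y`. By Euler's identity `∂/∂z₀` becomes `c - (x∂x + y∂y)`. Multiplication by `z_i` raises
the degree by one and `∂_j` lowers it, and they satisfy the Weyl relations once the degree is
tracked (`D_mul_z`, `D_mul_D`). So the `z_i ∂_j` represent `gl₃`; the traceless part acts by the
`J^i_c` and the identity by `c` (`L_eq`).

For `Δ = 1`, the pair (degree `n - 1`, degree `n`) consists of the components of a function of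
degree `n` in three even variables and one odd variable `θ`, the first being the coefficient of `θ`.
Here `z_i σ⁻` is `z_i ∂_θ` and `∂_j σ⁺` is `θ ∂_j`, which gives a representation of `gl(3, 1)`
(`superrep_superComm`), faithful for `n ≠ 0` (`superrep_injective`). The generators lie in the image
of `spl(3, 1)` and span it (`map_spl_eq`).

For `Δ = 0`, the Lie algebra is the image of `sl₃ ⊕ sl₂` acting on the tensor product of `ℂ[x, y]`
with `ℂ²` (`range_slRep`, `slRep_injective`). The superalgebra stays among matrices with entries in
the finite-dimensional space `gl₃ + ℂ` (`s_zero_le`).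

For `Δ ≥ 2`, brackets of `∂x^Δ σ⁺` with `σ⁻` and `x σ⁻` give `diag(∂x^Δ, ∂x^Δ)` and an element whose
bracket raises powers of `∂x` by `Δ - 1 > 0`. Thus infinitely many powers of `∂x` occur
(`diag_dx_pow_mem`). -/

theorem map_commutator_of_single {ι R : Type*} [Fintype ι] [DecidableEq ι] [Ring R] [Algebra ℂ R]
    (f : Matrix ι ι ℂ →ₗ[ℂ] R)
    (hf : ∀ i j k l, f (Matrix.single i j 1 * Matrix.single k l 1 -
        Matrix.single k l 1 * Matrix.single i j 1) =
      f (Matrix.single i j 1) * f (Matrix.single k l 1) -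
        f (Matrix.single k l 1) * f (Matrix.single i j 1))
    (A B : Matrix ι ι ℂ) : f (A * B - B * A) = f A * f B - f B * f A := by
  have h : (LinearMap.mul ℂ (Matrix ι ι ℂ) - (LinearMap.mul ℂ (Matrix ι ι ℂ)).flip).compr₂ f =
      (LinearMap.mul ℂ R - (LinearMap.mul ℂ R).flip).compl₁₂ f f := by
    refine Matrix.ext_linearMap ℂ fun i j => LinearMap.ext_ring ?_
    refine Matrix.ext_linearMap ℂ fun k l => LinearMap.ext_ring ?_
    exact hf i j k l
  exact LinearMap.congr_fun₂ h A B

/-! ### The homogeneous coordinates and their derivatives -/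

namespace PolyEnd

theorem dx_mul_x : dx * x = x * dx + 1 := by
  refine LinearMap.ext fun p => ?_
  simp [dx, x, Derivation.leibniz, add_comm]

theorem dy_mul_y : dy * y = y * dy + 1 := by
  refine LinearMap.ext fun p => ?_
  simp [dy, y, Derivation.leibniz, add_comm]

theorem dx_mul_y : dx * y = y * dx := by
  refine LinearMap.ext fun p => ?_
  simp [dx, y, Derivation.leibniz]

theorem dy_mul_x : dy * x = x * dy := by
  refine LinearMap.ext fun p => ?_
  simp [dy, x, Derivation.leibniz]

theorem y_mul_x : y * x = x * y := by
  refine LinearMap.ext fun p => ?_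
  simp [x, y, mul_left_comm]

theorem dy_mul_dx : dy * dx = dx * dy := by
  refine LinearMap.ext fun p => ?_
  have h : ⁅pderiv (R := ℂ) (0 : Fin 2), (pderiv (R := ℂ) (1 : Fin 2))⁆ = 0 := by
    refine MvPolynomial.derivation_ext fun i => ?_
    rw [Derivation.commutator_apply]
    fin_cases i <;> simp
  have h2 := congrArg (fun d => d p) h
  simp only [Derivation.commutator_apply, Derivation.coe_zero, Pi.zero_apply, sub_eq_zero] at h2
  exact h2.symm

/-- The homogeneous coordinates `1, x, y` as multiplication operators. -/
def z : Fin 3 → PolyEnd := ![1, x, y]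

/-- The partial derivatives in the homogeneous coordinates, acting on the dehomogenizations of
functions that are homogeneous of degree `c`. -/
def D (c : ℂ) : Fin 3 → PolyEnd := ![c • 1 - (x * dx + y * dy), dx, dy]

theorem z_mul_z (i j : Fin 3) : z i * z j = z j * z i := by
  fin_cases i <;> fin_cases j <;> simp [z, y_mul_x]

theorem x_mul_dx_add_mul_x : (x * dx + y * dy) * x = x * (x * dx + y * dy) + x := by
  rw [add_mul, mul_assoc, dx_mul_x, mul_assoc, dy_mul_x, ← mul_assoc y, y_mul_x]
  noncomm_ring

theorem x_mul_dx_add_mul_y : (x * dx + y * dy) * y = y * (x * dx + y * dy) + y := by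
  rw [add_mul, mul_assoc, dx_mul_y, mul_assoc, dy_mul_y, ← mul_assoc x, ← y_mul_x]
  noncomm_ring

theorem dx_mul_x_mul_dx_add : dx * (x * dx + y * dy) = (x * dx + y * dy) * dx + dx := by
  rw [mul_add, ← mul_assoc, dx_mul_x, ← mul_assoc, dx_mul_y, mul_assoc, ← dy_mul_dx]
  noncomm_ring

theorem dy_mul_x_mul_dx_add : dy * (x * dx + y * dy) = (x * dx + y * dy) * dy + dy := by
  rw [mul_add, ← mul_assoc, dy_mul_x, ← mul_assoc, dy_mul_y, mul_assoc, dy_mul_dx]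
  noncomm_ring

/-- The canonical commutation relations. The degree drops to `c - 1` on the right because `z k` no
longer acts before the derivative. -/
theorem D_mul_z (c : ℂ) (j k : Fin 3) :
    D c j * z k = z k * D (c - 1) j + if j = k then 1 else 0 := by
  fin_cases j <;> fin_cases k <;>
    simp [D, z, dx_mul_x, dx_mul_y, dy_mul_x, dy_mul_y, sub_mul, mul_sub, x_mul_dx_add_mul_x,
      x_mul_dx_add_mul_y, sub_smul]
  all_goals abel

theorem D_mul_D (c : ℂ) (i j : Fin 3) : D (c - 1) i * D c j = D (c - 1) j * D c i := by
  fin_cases i <;> fin_cases j <;>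
    simp [D, dy_mul_dx, sub_mul, mul_sub, dx_mul_x_mul_dx_add, dy_mul_x_mul_dx_add, sub_smul]
  all_goals abel

theorem z_mul_D_mul (c : ℂ) (i j k l : Fin 3) :
    z i * D c j * (z k * D c l) =
      z i * z k * (D (c - 1) j * D c l) + if j = k then z i * D c l else 0 := by
  rw [mul_assoc, ← mul_assoc (D c j), D_mul_z, add_mul, mul_add]
  split_ifs <;> simp [mul_assoc]

/-- After normal ordering, the second-order terms cancel because coordinates commute and derivatives
commute; the contractions left over are the structure constants of `gl₃`. -/
theorem z_mul_D_commutator (c : ℂ) (i j k l : Fin 3) :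
    z i * D c j * (z k * D c l) - z k * D c l * (z i * D c j) =
      (if j = k then z i * D c l else 0) - if l = i then z k * D c j else 0 := by
  rw [z_mul_D_mul, z_mul_D_mul, z_mul_z k i, D_mul_D c l j]
  abel

/-- The action of `gl₃` on functions that are homogeneous of degree `c`. -/
def L (c : ℂ) : Matrix (Fin 3) (Fin 3) ℂ →ₗ[ℂ] PolyEnd :=
  ∑ i, ∑ j, (Matrix.entryLinearMap ℂ ℂ i j).smulRight (z i * D c j)

theorem L_apply (c : ℂ) (A : Matrix (Fin 3) (Fin 3) ℂ) :
    L c A = ∑ i, ∑ j, A i j • (z i * D c j) := by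
  simp [L, LinearMap.sum_apply]

theorem L_single (c : ℂ) (i j : Fin 3) : L c (Matrix.single i j 1) = z i * D c j := by
  rw [L_apply, Finset.sum_eq_single i, Finset.sum_eq_single j]
  · simp
  · intro b _ hb; simp [hb.symm]
  · simp
  · intro b _ hb; simp [hb.symm]
  · simp

theorem L_commutator (c : ℂ) (A B : Matrix (Fin 3) (Fin 3) ℂ) :
    L c (A * B - B * A) = L c A * L c B - L c B * L c A := by
  refine map_commutator_of_single (L c) (fun i j k l => ?_) A B
  rw [L_single, L_single, z_mul_D_commutator, map_sub]
  congr 1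
  · split_ifs with h
    · subst h; simp [L_single]
    · simp [h]
  · split_ifs with h
    · subst h; simp [L_single]
    · simp [h]

/-- The coordinates of a traceless matrix in the basis of `sl₃` that acts by `J¹, …, J⁸`. -/
def slCoord (A : Matrix (Fin 3) (Fin 3) ℂ) : Fin 8 → ℂ :=
  ![-A 1 0, -A 2 0, A 2 1, A 0 1, A 0 2, A 1 2, A 1 1 - A 0 0, A 2 2 - A 0 0]

/-- The `c / 3` in `J⁷` and `J⁸` is exactly what makes them the action of traceless matrices, so the
trace contributes only a constant. -/
theorem L_eq (c : ℂ) (A : Matrix (Fin 3) (Fin 3) ℂ) :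
    L c A = (∑ i, slCoord A i • J c i) + (c / 3 * A.trace) • (1 : PolyEnd) := by
  have e1 : x * (y * dy) = x * y * dy := (mul_assoc _ _ _).symm
  have e2 : y * (x * dx) = x * y * dx := by rw [← mul_assoc, y_mul_x]
  have e3 : x * (x * dx) = x ^ 2 * dx := by rw [← mul_assoc, sq]
  have e4 : y * (y * dy) = y ^ 2 * dy := by rw [← mul_assoc, sq]
  simp only [L_apply, Fin.sum_univ_succ, Matrix.trace, Matrix.diag, z, D, J, slCoord]
  simp [mul_add, mul_sub, e1, e2, e3, e4]
  module

/-! ### Faithfulness: testing operators on `1`, `x`, `y` -/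

theorem L_apply_one (c : ℂ) (A : Matrix (Fin 3) (Fin 3) ℂ) :
    L c A 1 = C (c * A 0 0) + C (c * A 1 0) * X 0 + C (c * A 2 0) * X 1 := by
  simp [L_apply, Fin.sum_univ_succ, z, D, x, y, dx, dy, smul_eq_C_mul]
  ring

theorem L_apply_X_zero (c : ℂ) (A : Matrix (Fin 3) (Fin 3) ℂ) :
    L c A (X 0) = C (A 0 1) + C ((c - 1) * A 0 0 + A 1 1) * X 0 + C (A 2 1) * X 1 +
      C ((c - 1) * A 1 0) * X 0 ^ 2 + C ((c - 1) * A 2 0) * (X 0 * X 1) := by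
  simp [L_apply, Fin.sum_univ_succ, z, D, x, y, dx, dy, smul_eq_C_mul]
  ring

theorem L_apply_X_one (c : ℂ) (A : Matrix (Fin 3) (Fin 3) ℂ) :
    L c A (X 1) = C (A 0 2) + C (A 1 2) * X 0 + C ((c - 1) * A 0 0 + A 2 2) * X 1 +
      C ((c - 1) * A 1 0) * (X 0 * X 1) + C ((c - 1) * A 2 0) * X 1 ^ 2 := by
  simp [L_apply, Fin.sum_univ_succ, z, D, x, y, dx, dy, smul_eq_C_mul]
  ring

/-- The coefficients are Taylor coefficients at the origin, read off by iterated derivatives. That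
of `y²` is never needed below. -/
theorem quadratic_coeffs_eq_zero {a b d e f g : ℂ}
    (h : C a + C b * X 0 + C d * X 1 + C e * X 0 ^ 2 + C f * (X 0 * X 1) + C g * X 1 ^ 2 =
      (0 : MvPolynomial (Fin 2) ℂ)) : a = 0 ∧ b = 0 ∧ d = 0 ∧ e = 0 ∧ f = 0 := by
  have h0 := congrArg (eval (0 : Fin 2 → ℂ)) h
  have h1 := congrArg (fun q => eval (0 : Fin 2 → ℂ) (pderiv 0 q)) h
  have h2 := congrArg (fun q => eval (0 : Fin 2 → ℂ) (pderiv 1 q)) h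
  have h3 := congrArg (fun q => eval (0 : Fin 2 → ℂ) (pderiv 0 (pderiv 0 q))) h
  have h4 := congrArg (fun q => eval (0 : Fin 2 → ℂ) (pderiv 0 (pderiv 1 q))) h
  simp at h0 h1 h2 h3 h4
  have h5 : constantCoeff (2 : MvPolynomial (Fin 2) ℂ) ≠ 0 := by simp [map_ofNat]
  exact ⟨h0, h1, h2, h3.resolve_right h5, h4⟩

theorem L_eq_zero {c : ℂ} {A : Matrix (Fin 3) (Fin 3) ℂ} (h : L c A = 0) :
    A = A 0 0 • 1 ∧ c * A 0 0 = 0 := by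
  have h1 := L_apply_one c A
  have hx := L_apply_X_zero c A
  have hy := L_apply_X_one c A
  rw [h, LinearMap.zero_apply] at h1 hx hy
  obtain ⟨a1, a2, a3, -, -⟩ := quadratic_coeffs_eq_zero (a := c * A 0 0) (b := c * A 1 0)
    (d := c * A 2 0) (e := 0) (f := 0) (g := 0) (by rw [C_0]; linear_combination -h1)
  obtain ⟨b1, b2, b3, b4, b5⟩ := quadratic_coeffs_eq_zero (a := A 0 1)
    (b := (c - 1) * A 0 0 + A 1 1) (d := A 2 1) (e := (c - 1) * A 1 0) (f := (c - 1) * A 2 0)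
    (g := 0) (by rw [C_0]; linear_combination -hx)
  obtain ⟨d1, d2, d3, -, -⟩ := quadratic_coeffs_eq_zero (a := A 0 2) (b := A 1 2)
    (d := (c - 1) * A 0 0 + A 2 2) (e := 0) (f := (c - 1) * A 1 0) (g := (c - 1) * A 2 0)
    (by rw [C_0]; linear_combination -hy)
  refine ⟨?_, a1⟩
  ext i j
  fin_cases i <;> fin_cases j <;> simp [b1, b3, d1, d2]
  -- The value at `1` gives `c * A 1 0 = 0` and the value at `x` gives `(c - 1) * A 1 0 = 0`; their
  -- difference works for every `c`. The other entries of the first column are similar.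
  · linear_combination a2 - b4
  · linear_combination b2 - a1
  · linear_combination a3 - b5
  · linear_combination d3 - a1

theorem z_linear_independent {a b d : ℂ} (h : a • z 0 + b • z 1 + d • z 2 = 0) :
    a = 0 ∧ b = 0 ∧ d = 0 := by
  have h1 := LinearMap.congr_fun h 1
  obtain ⟨a1, a2, a3, -, -⟩ := quadratic_coeffs_eq_zero (a := a) (b := b) (d := d) (e := 0) (f := 0)
    (g := 0) (by simpa [z, x, y, smul_eq_C_mul] using h1)
  exact ⟨a1, a2, a3⟩

theorem D_linear_independent {c : ℂ} (hc : c ≠ 0) {a b d : ℂ}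
    (h : a • D c 0 + b • D c 1 + d • D c 2 = 0) : a = 0 ∧ b = 0 ∧ d = 0 := by
  have h1 := LinearMap.congr_fun h 1
  have hx := LinearMap.congr_fun h (X 0)
  have hy := LinearMap.congr_fun h (X 1)
  have ha : a = 0 := by simpa [D, dx, dy, x, y, hc] using h1
  subst ha
  exact ⟨rfl, by simpa [D, dx, dy] using hx, by simpa [D, dx, dy] using hy⟩

end PolyEnd

/-! ### Generalities on Lie superalgebras -/

namespace LieSuperalgebra

theorem exists_add {L : Type*} [AddCommGroup L] [Module ℂ L] (A : LieSuperalgebra L) (x : L) :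
    ∃ x₀ ∈ A.grading 0, ∃ x₁ ∈ A.grading 1, x₀ + x₁ = x := by
  have h : x ∈ A.grading 0 ⊔ A.grading 1 := by rw [A.isCompl.sup_eq_top]; trivial
  exact Submodule.mem_sup.1 h

theorem add_injective {L : Type*} [AddCommGroup L] [Module ℂ L] (A : LieSuperalgebra L)
    {x₀ x₁ y₀ y₁ : L} (hx₀ : x₀ ∈ A.grading 0) (hx₁ : x₁ ∈ A.grading 1) (hy₀ : y₀ ∈ A.grading 0)
    (hy₁ : y₁ ∈ A.grading 1) (h : x₀ + x₁ = y₀ + y₁) : x₀ = y₀ ∧ x₁ = y₁ := by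
  have h0 : x₀ - y₀ = y₁ - x₁ := by
    rw [sub_eq_sub_iff_add_eq_add, h, add_comm]
  have h1 : x₀ - y₀ = 0 := (Submodule.disjoint_def.1 A.isCompl.disjoint) _
    (Submodule.sub_mem _ hx₀ hy₀) (h0 ▸ Submodule.sub_mem _ hy₁ hx₁)
  exact ⟨sub_eq_zero.1 h1, (sub_eq_zero.1 (h0.symm.trans h1)).symm⟩

/-- The inverse of an isomorphism of Lie superalgebras. -/
def Iso.symm {L L' : Type*} [AddCommGroup L] [Module ℂ L] [AddCommGroup L'] [Module ℂ L']
    {A : LieSuperalgebra L} {B : LieSuperalgebra L'} (e : Iso A B) : Iso B A where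
  toLinearEquiv := e.toLinearEquiv.symm
  map_grading k y hy := by
    -- Split the preimage by parity: since decompositions in the target are unique, the component of
    -- the wrong parity maps to zero.
    obtain ⟨x₀, h₀, x₁, h₁, h⟩ := A.exists_add (e.toLinearEquiv.symm y)
    have hy' : y = e.toLinearEquiv x₀ + e.toLinearEquiv x₁ := by
      rw [← map_add, h, LinearEquiv.apply_symm_apply]
    have h2 : ∀ k : ZMod 2, k = 0 ∨ k = 1 := by decide
    rw [← h]
    rcases h2 k with rfl | rfl
    · have := (B.add_injective (e.map_grading 0 _ h₀) (e.map_grading 1 _ h₁) hy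
        (Submodule.zero_mem _) (by rw [← hy', add_zero])).2
      rw [(LinearEquiv.map_eq_zero_iff _).1 this, add_zero]
      exact h₀
    · have := (B.add_injective (e.map_grading 0 _ h₀) (e.map_grading 1 _ h₁)
        (Submodule.zero_mem _) hy (by rw [← hy', zero_add])).1
      rw [(LinearEquiv.map_eq_zero_iff _).1 this, zero_add]
      exact h₁
  map_bracket x y := by
    apply e.toLinearEquiv.injective
    rw [e.map_bracket]
    simp

/-- The image of a Lie sub-superalgebra under a homomorphism. -/
def Sub.map {L L' : Type*} [AddCommGroup L] [Module ℂ L] [AddCommGroup L'] [Module ℂ L']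
    {A : LieSuperalgebra L} {B : LieSuperalgebra L'} (S : A.Sub) (f : L →ₗ[ℂ] L')
    (hg : ∀ k, ∀ x ∈ A.grading k, f x ∈ B.grading k)
    (hb : ∀ x y, f (A.bracket x y) = B.bracket (f x) (f y)) : B.Sub where
  toSubmodule := S.toSubmodule.map f
  graded x hx y hy h := by
    obtain ⟨w, hw, hw'⟩ := h
    obtain ⟨w₀, h₀, w₁, h₁, rfl⟩ := A.exists_add w
    obtain ⟨m₀, m₁⟩ := S.graded w₀ h₀ w₁ h₁ hw
    rw [map_add] at hw'
    obtain ⟨rfl, rfl⟩ := B.add_injective (hg 0 _ h₀) (hg 1 _ h₁) hx hy hw'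
    exact ⟨⟨w₀, m₀, rfl⟩, ⟨w₁, m₁, rfl⟩⟩
  bracket_mem := by
    rintro _ ⟨x, hx, rfl⟩ _ ⟨y, hy, rfl⟩
    exact ⟨_, S.bracket_mem x hx y hy, hb x y⟩

theorem subset_lieSpan {L : Type*} [AddCommGroup L] [Module ℂ L] (A : LieSuperalgebra L)
    (s : Set L) : s ⊆ (A.lieSpan s).toSubmodule := fun _ hx =>
  Submodule.mem_sInf.2 (by rintro N ⟨S, hS, rfl⟩; exact hS hx)

theorem lieSpan_le {L : Type*} [AddCommGroup L] [Module ℂ L] {A : LieSuperalgebra L}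
    {s : Set L} {S : A.Sub} (h : s ⊆ S.toSubmodule) :
    (A.lieSpan s).toSubmodule ≤ S.toSubmodule :=
  sInf_le ⟨S, h, rfl⟩

/-- An injective homomorphism whose image of the Lie sub-superalgebra `S` is `S'` gives an
isomorphism of `S` with `S'`. -/
def Sub.isoOfMapEq {L L' : Type*} [AddCommGroup L] [Module ℂ L] [AddCommGroup L'] [Module ℂ L']
    {A : LieSuperalgebra L} {B : LieSuperalgebra L'} (S : A.Sub) (S' : B.Sub) (f : L →ₗ[ℂ] L')
    (hf : Function.Injective f) (hg : ∀ k, ∀ x ∈ A.grading k, f x ∈ B.grading k)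
    (hb : ∀ x y, f (A.bracket x y) = B.bracket (f x) (f y))
    (h : S.toSubmodule.map f = S'.toSubmodule) :
    Iso S.toLieSuperalgebra S'.toLieSuperalgebra where
  toLinearEquiv := (Submodule.equivMapOfInjective f hf S.toSubmodule).trans
    (LinearEquiv.ofEq _ _ h)
  map_grading k _ hx := hg k _ hx
  map_bracket x y := Subtype.ext (hb x y)

end LieSuperalgebra

/-! ### The supercommutator of matrices of operators -/

/-- Makes the sign rule explicit for arguments that need not be homogeneous: diagonal entries enter
through commutators, pairs of off-diagonal entries through anticommutators. -/
theorem superComm_fin_two {R : Type*} [Ring R] [Algebra ℂ R] (M N : Matrix (Fin 2) (Fin 2) R) :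
    SuperMatrix.superComm ![0, 1] M N =
      !![M 0 0 * N 0 0 - N 0 0 * M 0 0 + (M 0 1 * N 1 0 + N 0 1 * M 1 0),
        M 0 0 * N 0 1 - N 0 1 * M 1 1 + (M 0 1 * N 1 1 - N 0 0 * M 0 1);
        M 1 0 * N 0 0 - N 1 1 * M 1 0 + (M 1 1 * N 1 0 - N 1 0 * M 0 0),
        M 1 1 * N 1 1 - N 1 1 * M 1 1 + (M 1 0 * N 0 1 + N 1 0 * M 0 1)] := by
  have hu : (Finset.univ : Finset (ZMod 2)) = {0, 1} := by decide
  have h11 : (1 : ZMod 2) + 1 = 0 := by decide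
  ext i j
  fin_cases i <;> fin_cases j <;>
    simp [SuperMatrix.superComm, hu, superSign, SuperMatrix.proj, Matrix.mul_apply,
      Fin.sum_univ_two, h11]
  all_goals noncomm_ring

theorem superComm_single {ι : Type*} [Fintype ι] [DecidableEq ι] (par : ι → ZMod 2)
    (i j k l : ι) :
    SuperMatrix.superComm par (Matrix.single i j (1 : ℂ)) (Matrix.single k l 1) =
      (if j = k then Matrix.single i l 1 else 0) -
        superSign (par i + par j) (par k + par l) • (if l = i then Matrix.single k j 1 else 0) := by
  have h : ∀ i j, Matrix.single i j (1 : ℂ) ∈ SuperMatrix.degreePart ℂ par (par i + par j) := by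
    intro i j a b hab
    rw [Matrix.single_apply_of_ne]
    rintro ⟨rfl, rfl⟩
    exact hab rfl
  rw [SuperMatrix.superComm_of_mem par (h i j) (h k l)]
  congr 1
  · split_ifs with hjk
    · subst hjk; simp
    · simp [hjk]
  · split_ifs with hjk
    · subst hjk; simp
    · simp [hjk]

/-! ### The representation of `gl(3, 1)` by matrices of differential operators -/

theorem map_superComm_of_single {ι κ R : Type*} [Fintype ι] [DecidableEq ι] [Fintype κ]
    [DecidableEq κ] [Ring R] [Algebra ℂ R] (par : ι → ZMod 2) (par' : κ → ZMod 2)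
    (f : Matrix ι ι ℂ →ₗ[ℂ] Matrix κ κ R)
    (hf : ∀ i j k l,
      f (SuperMatrix.superComm par (Matrix.single i j 1) (Matrix.single k l 1)) =
        SuperMatrix.superComm par' (f (Matrix.single i j 1)) (f (Matrix.single k l 1)))
    (A B : Matrix ι ι ℂ) :
    f (SuperMatrix.superComm par A B) = SuperMatrix.superComm par' (f A) (f B) := by
  have h : (SuperMatrix.superComm par).compr₂ f = (SuperMatrix.superComm par').compl₁₂ f f := by
    refine Matrix.ext_linearMap ℂ fun i j => LinearMap.ext_ring ?_
    refine Matrix.ext_linearMap ℂ fun k l => LinearMap.ext_ring ?_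
    exact hf i j k l
  exact LinearMap.congr_fun₂ h A B

namespace Triangular

open PolyEnd

/-- The operators by which the elementary matrices of `gl(3, 1)` act. -/
def E (c : ℂ) : Fin 3 ⊕ Fin 1 → Fin 3 ⊕ Fin 1 → MatOp
  | .inl i, .inl j => !![z i * D (c - 1) j, 0; 0, z i * D c j]
  | .inl i, .inr _ => !![0, 0; z i, 0]
  | .inr _, .inl j => !![0, D c j; 0, 0]
  | .inr _, .inr _ => !![1, 0; 0, 0]

theorem D_mul_z_mul (c : ℂ) (j k : Fin 3) (w : PolyEnd) :
    D c j * (z k * w) = z k * (D (c - 1) j * w) + if j = k then w else 0 := by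
  rw [← mul_assoc, D_mul_z, add_mul, mul_assoc]
  split_ifs <;> simp

theorem z_mul_z_mul (i j : Fin 3) (w : PolyEnd) : z i * (z j * w) = z j * (z i * w) := by
  rw [← mul_assoc, z_mul_z, mul_assoc]

/-- These are the relations of `gl(3, 1)`. The essential odd one comes from `D_mul_z`: anticommuting
`∂_j σ⁺` with `z_i σ⁻` puts `∂_j z_i = z_i ∂_j + δ_ij` in the upper corner and `z_i ∂_j` in the
lower one, and the extra `δ_ij` is the last diagonal unit. -/
theorem E_superComm (c : ℂ) (i j k l : Fin 3 ⊕ Fin 1) :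
    SuperMatrix.superComm ![0, 1] (E c i j) (E c k l) =
      (if j = k then E c i l else 0) -
        superSign (blockParity 3 1 i + blockParity 3 1 j) (blockParity 3 1 k + blockParity 3 1 l) •
          (if l = i then E c k j else 0) := by
  have h11 : (1 : ZMod 2) + 1 = 0 := by decide
  have hs : ∀ a b : Fin 1, a = b ↔ True := by decide
  rw [superComm_fin_two]
  refine Matrix.ext fun a b => ?_
  rcases i with i | i <;> rcases j with j | j <;> rcases k with k | k <;> rcases l with l | l <;>
    fin_cases a <;> fin_cases b <;>
    simp [E, superSign, blockParity, h11, hs, mul_assoc, D_mul_z, D_mul_z_mul, D_mul_D, z_mul_z_mul, mul_add,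
      apply_ite (fun M : MatOp => M 0 0), apply_ite (fun M : MatOp => M 0 1),
      apply_ite (fun M : MatOp => M 1 0), apply_ite (fun M : MatOp => M 1 1)]

  · split_ifs <;> module
  · module
  · module

/-- The representation of `gl(3, 1)` by `2 × 2` matrices of differential operators. -/
def superrep (c : ℂ) : Matrix (Fin 3 ⊕ Fin 1) (Fin 3 ⊕ Fin 1) ℂ →ₗ[ℂ] MatOp :=
  ∑ i, ∑ j, (Matrix.entryLinearMap ℂ ℂ i j).smulRight (E c i j)

theorem superrep_eq_sum (c : ℂ) (M : Matrix (Fin 3 ⊕ Fin 1) (Fin 3 ⊕ Fin 1) ℂ) :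
    superrep c M = ∑ i, ∑ j, M i j • E c i j := by
  simp [superrep, LinearMap.sum_apply]

theorem superrep_single (c : ℂ) (i j : Fin 3 ⊕ Fin 1) :
    superrep c (Matrix.single i j 1) = E c i j := by
  rw [superrep_eq_sum, Finset.sum_eq_single i, Finset.sum_eq_single j]
  · simp
  · intro b _ hb; simp [hb.symm]
  · simp
  · intro b _ hb; simp [hb.symm]
  · simp

theorem superrep_superComm (c : ℂ) (M N : Matrix (Fin 3 ⊕ Fin 1) (Fin 3 ⊕ Fin 1) ℂ) :
    superrep c (SuperMatrix.superComm (blockParity 3 1) M N) =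
      SuperMatrix.superComm ![0, 1] (superrep c M) (superrep c N) := by
  refine map_superComm_of_single _ _ (superrep c) (fun i j k l => ?_) M N
  rw [superComm_single, superrep_single, superrep_single, E_superComm, map_sub, map_smul,
    apply_ite (superrep c), apply_ite (superrep c), superrep_single, superrep_single, map_zero]

theorem superrep_apply (c : ℂ) (M : Matrix (Fin 3 ⊕ Fin 1) (Fin 3 ⊕ Fin 1) ℂ) :
    superrep c M =
      !![L (c - 1) M.toBlocks₁₁ + M (.inr 0) (.inr 0) • (1 : PolyEnd),
          M (.inr 0) (.inl 0) • D c 0 + M (.inr 0) (.inl 1) • D c 1 + M (.inr 0) (.inl 2) • D c 2;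
        M (.inl 0) (.inr 0) • z 0 + M (.inl 1) (.inr 0) • z 1 + M (.inl 2) (.inr 0) • z 2,
          L c M.toBlocks₁₁] := by
  rw [superrep_eq_sum]
  refine Matrix.ext fun a b => ?_
  fin_cases a <;> fin_cases b <;>
    simp [E, L_apply, Matrix.sum_apply, Fin.sum_univ_three, Matrix.toBlocks₁₁]

/-- The identity of `gl(3, 1)` acts by the scalar `c`, so `c ≠ 0` cannot be dropped. The lower right
entry kills the `gl₃` block, and then the upper left one kills the remaining diagonal entry. -/
theorem superrep_injective {c : ℂ} (hc : c ≠ 0) : Function.Injective (superrep c) := by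
  rw [injective_iff_map_eq_zero]
  intro M hM
  rw [superrep_apply] at hM
  have h00 := congrFun (congrFun hM 0) 0
  have h01 := congrFun (congrFun hM 0) 1
  have h10 := congrFun (congrFun hM 1) 0
  have h11 := congrFun (congrFun hM 1) 1
  simp only [Matrix.of_apply, Matrix.cons_val, Matrix.zero_apply] at h00 h01 h10 h11
  obtain ⟨h1, h2⟩ := L_eq_zero h11
  have hA : M.toBlocks₁₁ = 0 := by rw [h1, (mul_eq_zero.1 h2).resolve_left hc, zero_smul]
  rw [hA, map_zero, zero_add] at h00
  have h3 := LinearMap.congr_fun h00 1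
  have h4 : M (.inr 0) (.inr 0) = 0 := by simpa using h3
  obtain ⟨d0, d1, d2⟩ := D_linear_independent hc h01
  obtain ⟨e0, e1, e2⟩ := z_linear_independent h10
  have hA' : ∀ i j, M (.inl i) (.inl j) = 0 := fun i j => congrFun (congrFun hA i) j
  ext i j
  rcases i with i | i <;> rcases j with j | j
  · exact hA' i j
  · fin_cases j; fin_cases i <;> assumption
  · fin_cases i; fin_cases j <;> assumption
  · fin_cases i; fin_cases j; assumption

theorem superrep_mem_degreePart (c : ℂ) (k : ZMod 2)
    (M : Matrix (Fin 3 ⊕ Fin 1) (Fin 3 ⊕ Fin 1) ℂ)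
    (hM : M ∈ SuperMatrix.degreePart ℂ (blockParity 3 1) k) :
    superrep c M ∈ SuperMatrix.degreePart PolyEnd ![0, 1] k := by
  have h2 : ∀ u : ZMod 2, u = 0 ∨ u = 1 := by decide
  have hM' : ∀ i j, blockParity 3 1 i + blockParity 3 1 j ≠ k → M i j = 0 := hM
  have h11 : (1 : ZMod 2) + 1 = 0 := by decide
  rw [superrep_apply]
  intro i j h
  rcases h2 k with rfl | rfl
  · fin_cases i <;> fin_cases j <;> simp [h11] at h <;> simp [hM', blockParity]
  · have hA : M.toBlocks₁₁ = 0 := by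
      ext i j
      exact hM' _ _ (by simp [blockParity])
    fin_cases i <;> fin_cases j <;> simp at h <;> simp [hM', blockParity, hA, h11]

/-- The traceless matrices that act by `J¹, …, J⁸`. -/
def slBasis : Fin 8 → Matrix (Fin 3) (Fin 3) ℂ :=
  ![-Matrix.single 1 0 1, -Matrix.single 2 0 1, Matrix.single 2 1 1, Matrix.single 0 1 1,
    Matrix.single 0 2 1, Matrix.single 1 2 1, Matrix.single 1 1 1 - (1 / 3 : ℂ) • 1,
    Matrix.single 2 2 1 - (1 / 3 : ℂ) • 1]

theorem trace_slBasis (i : Fin 8) : (slBasis i).trace = 0 := by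
  fin_cases i <;> simp [slBasis]

theorem L_one (c : ℂ) : L c 1 = c • 1 := by
  simp [L_eq, slCoord, Fin.sum_univ_succ]

theorem L_slBasis (c : ℂ) (i : Fin 8) : L c (slBasis i) = PolyEnd.J c i := by
  rw [L_eq, trace_slBasis, mul_zero, zero_smul, add_zero]
  fin_cases i <;> simp [slBasis, slCoord, Fin.sum_univ_succ]

/-! ### The generators for `Δ = 1` and the image of `spl(3, 1)` -/

theorem natCast_sub_one (n : ℕ) : (n : ℂ) - ((1 : ℕ) : ℂ) = n - 1 := by simp

theorem T_eq_superrep (n : ℕ) (i : Fin 8) :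
    T n 1 i = superrep n (Matrix.fromBlocks (slBasis i) 0 0 0) := by
  rw [superrep_apply, T, natCast_sub_one, Matrix.toBlocks_fromBlocks₁₁, L_slBasis, L_slBasis]
  simp

theorem J_eq_superrep (n : ℕ) :
    J n 1 = superrep n (Matrix.fromBlocks ((1 / 3 : ℂ) • 1) 0 0 1) := by
  rw [superrep_apply, J, Matrix.toBlocks_fromBlocks₁₁, map_smul, map_smul, L_one, L_one]
  refine Matrix.ext fun a b => ?_
  fin_cases a <;> fin_cases b <;> simp
  · module
  · module

theorem generators_subset_map_spl (n : ℕ) :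
    generators n 1 ⊆ (spl 3 1).toSubmodule.map (superrep n) := by
  have hsp : ∀ M : Matrix (Fin 3 ⊕ Fin 1) (Fin 3 ⊕ Fin 1) ℂ,
      M.toBlocks₁₁.trace = M (.inr 0) (.inr 0) → M ∈ (spl 3 1).toSubmodule := by
    intro M hM
    change SuperMatrix.supertrace (blockParity 3 1) M = 0
    simpa [SuperMatrix.supertrace, blockParity, Matrix.trace, Matrix.toBlocks₁₁, ← sub_eq_add_neg,
      sub_eq_zero] using hM
  rintro _ (((⟨i, rfl⟩ | rfl) | ⟨a, b, hab, rfl⟩) | ⟨a, b, hab, rfl⟩)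
  · exact ⟨_, hsp _ (by simp [trace_slBasis]), (T_eq_superrep n i).symm⟩
  · exact ⟨_, hsp _ (by simp), (J_eq_superrep n).symm⟩
  · obtain ⟨rfl, rfl⟩ | ⟨rfl, rfl⟩ | ⟨rfl, rfl⟩ :
        (a = 0 ∧ b = 0) ∨ (a = 1 ∧ b = 0) ∨ (a = 0 ∧ b = 1) := by omega
    · exact ⟨Matrix.single (.inl 0) (.inr 0) 1, hsp _ (by simp [Matrix.trace, Matrix.toBlocks₁₁]),
        by simp [superrep_single, E, Qminus, q, z]⟩
    · exact ⟨Matrix.single (.inl 1) (.inr 0) 1, hsp _ (by simp [Matrix.trace, Matrix.toBlocks₁₁]),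
        by simp [superrep_single, E, Qminus, q, z]⟩
    · exact ⟨Matrix.single (.inl 2) (.inr 0) 1, hsp _ (by simp [Matrix.trace, Matrix.toBlocks₁₁]),
        by simp [superrep_single, E, Qminus, q, z]⟩
  · obtain ⟨rfl, rfl⟩ | ⟨rfl, rfl⟩ | ⟨rfl, rfl⟩ :
        (a = 0 ∧ b = 0) ∨ (a = 1 ∧ b = 0) ∨ (a = 0 ∧ b = 1) := by omega
    -- For `Δ = 1` the single factor of `Q⁺_{00}` is `x∂x + y∂y - n`, the negative of `D n 0`; hence
    -- the sign.
    · exact ⟨-Matrix.single (.inr 0) (.inl 0) 1, hsp _ (by simp [Matrix.trace, Matrix.toBlocks₁₁]),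
        by simp [superrep_single, E, Qplus, qbar, D]⟩
    · exact ⟨Matrix.single (.inr 0) (.inl 1) 1, hsp _ (by simp [Matrix.trace, Matrix.toBlocks₁₁]),
        by simp [superrep_single, E, Qplus, qbar, D]⟩
    · exact ⟨Matrix.single (.inr 0) (.inl 2) 1, hsp _ (by simp [Matrix.trace, Matrix.toBlocks₁₁]),
        by simp [superrep_single, E, Qplus, qbar, D]⟩

/-- The generators already span the image. Supertrace zero equates the trace `t` of the `3 × 3`
block with the last diagonal entry, so the constants left over from `L_eq` are `(n - 1)t/3 + t = (n
+ 2)t/3` and `nt/3`, which is `t • J`. -/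
theorem superrep_eq (n : ℕ) {M : Matrix (Fin 3 ⊕ Fin 1) (Fin 3 ⊕ Fin 1) ℂ}
    (hM : M ∈ (spl 3 1).toSubmodule) :
    superrep n M = ∑ i, slCoord M.toBlocks₁₁ i • T n 1 i +
       M (.inr 0) (.inr 0) • J n 1 +
      (M (.inl 0) (.inr 0) • Qminus 0 0 + M (.inl 1) (.inr 0) • Qminus 1 0 +
        M (.inl 2) (.inr 0) • Qminus 0 1) +
      (-M (.inr 0) (.inl 0) • Qplus n 1 0 0 + M (.inr 0) (.inl 1) • Qplus n 1 1 0 +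
        M (.inr 0) (.inl 2) • Qplus n 1 0 1) := by
  have ht : M.toBlocks₁₁.trace = M (.inr 0) (.inr 0) := by
    have h : SuperMatrix.supertrace (blockParity 3 1) M = 0 := hM
    simpa [SuperMatrix.supertrace, blockParity, Matrix.trace, Matrix.toBlocks₁₁, ← sub_eq_add_neg,
      sub_eq_zero] using h
  rw [superrep_apply, L_eq, L_eq, ht]
  refine Matrix.ext fun a b => ?_
  fin_cases a <;> fin_cases b <;>
    simp [T, J, Qminus, Qplus, q, qbar, z, D, Matrix.sum_apply]
  · rw [add_assoc]
    congr 1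
    module
  · module
  · module

theorem map_spl_eq (n : ℕ) : (spl 3 1).toSubmodule.map (superrep n) = (s n 1).toSubmodule := by
  apply le_antisymm
  · rintro _ ⟨M, hM, rfl⟩
    have hg : generators n 1 ⊆ (s n 1).toSubmodule := matOpSuper.subset_lieSpan _
    have hT : ∀ i, T n 1 i ∈ (s n 1).toSubmodule := fun i => hg (.inl (.inl (.inl ⟨i, rfl⟩)))
    have hJ : J n 1 ∈ (s n 1).toSubmodule := hg (.inl (.inl (.inr rfl)))
    have hm : ∀ a b, a + b ≤ 1 → Qminus a b ∈ (s n 1).toSubmodule :=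
      fun a b h => hg (.inl (.inr ⟨a, b, h, rfl⟩))
    have hp : ∀ a b, a + b ≤ 1 → Qplus n 1 a b ∈ (s n 1).toSubmodule :=
      fun a b h => hg (.inr ⟨a, b, h, rfl⟩)
    rw [superrep_eq n hM]
    refine add_mem (add_mem (add_mem (sum_mem fun i _ => Submodule.smul_mem _ _ (hT i))
      (Submodule.smul_mem _ _ hJ)) (add_mem (add_mem ?_ ?_) ?_)) (add_mem (add_mem ?_ ?_) ?_)
    · exact Submodule.smul_mem _ _ (hm 0 0 (by norm_num))
    · exact Submodule.smul_mem _ _ (hm 1 0 (by norm_num))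
    · exact Submodule.smul_mem _ _ (hm 0 1 (by norm_num))
    · exact Submodule.smul_mem _ _ (hp 0 0 (by norm_num))
    · exact Submodule.smul_mem _ _ (hp 1 0 (by norm_num))
    · exact Submodule.smul_mem _ _ (hp 0 1 (by norm_num))
  · exact LieSuperalgebra.lieSpan_le (A := matOpSuper)
      (S := (spl 3 1).map (B := matOpSuper) (superrep n) (superrep_mem_degreePart n)
        (superrep_superComm n)) (generators_subset_map_spl n)

/-- `s¹_n` is isomorphic to `spl(3, 1)`. -/
theorem nonempty_iso_spl {n : ℕ} (hn : 1 ≤ n) :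
    Nonempty (LieSuperalgebra.Iso (s n 1).toLieSuperalgebra (spl 3 1).toLieSuperalgebra) :=
  ⟨(LieSuperalgebra.Sub.isoOfMapEq (B := matOpSuper) (spl 3 1) (s n 1) (superrep n)
    (superrep_injective (by exact_mod_cast (by omega : n ≠ 0))) (superrep_mem_degreePart n)
    (superrep_superComm n) (map_spl_eq n)).symm⟩

theorem finiteDimensional_s_one (n : ℕ) : FiniteDimensional ℂ (s n 1).toSubmodule := by
  rw [← map_spl_eq]
  infer_instance

/-! ### The case `Δ = 0` -/

/-- The operators by which `gl₃` acts, together with the constants. -/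
def glRange (c : ℂ) : Submodule ℂ PolyEnd := LinearMap.range (L c) ⊔ ℂ ∙ (1 : PolyEnd)

theorem commutator_mem_glRange {c : ℂ} {a b : PolyEnd} (ha : a ∈ glRange c)
    (hb : b ∈ glRange c) : a * b - b * a ∈ glRange c := by
  obtain ⟨_, ⟨A, rfl⟩, _, ha', rfl⟩ := Submodule.mem_sup.1 ha
  obtain ⟨u, rfl⟩ := Submodule.mem_span_singleton.1 ha'
  obtain ⟨_, ⟨B, rfl⟩, _, hb', rfl⟩ := Submodule.mem_sup.1 hb
  obtain ⟨v, rfl⟩ := Submodule.mem_span_singleton.1 hb'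
  refine Submodule.mem_sup_left ⟨A * B - B * A, ?_⟩
  rw [L_commutator]
  simp only [add_mul, mul_add, smul_mul_assoc, mul_smul_comm, one_mul, mul_one]
  module

theorem one_mem_glRange (c : ℂ) : (1 : PolyEnd) ∈ glRange c :=
  Submodule.mem_sup_right (Submodule.mem_span_singleton_self _)

/-- The matrices whose entries are in `gl₃` or constants, with constant off-diagonal entries
and constant difference of the diagonal entries. -/
def glSub (c : ℂ) : matOpSuper.Sub where
  carrier := {M | M 1 1 ∈ glRange c ∧ M 0 0 - M 1 1 ∈ ℂ ∙ (1 : PolyEnd) ∧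
    M 0 1 ∈ ℂ ∙ (1 : PolyEnd) ∧ M 1 0 ∈ ℂ ∙ (1 : PolyEnd)}
  add_mem' {a b} ha hb := by
    refine ⟨add_mem ha.1 hb.1, ?_, add_mem ha.2.2.1 hb.2.2.1, add_mem ha.2.2.2 hb.2.2.2⟩
    have := add_mem ha.2.1 hb.2.1
    rwa [sub_add_sub_comm] at this
  zero_mem' := by simp
  smul_mem' c M hM := by
    refine ⟨Submodule.smul_mem _ c hM.1, ?_, Submodule.smul_mem _ c hM.2.2.1,
      Submodule.smul_mem _ c hM.2.2.2⟩
    have := Submodule.smul_mem _ c hM.2.1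
    rwa [smul_sub] at this
  graded M hM N hN h := by
    have hM' : ∀ i j : Fin 2, (![0, 1] : Fin 2 → ZMod 2) i + (![0, 1] : Fin 2 → ZMod 2) j ≠ 0 →
      M i j = 0 := hM
    have hN' : ∀ i j : Fin 2, (![0, 1] : Fin 2 → ZMod 2) i + (![0, 1] : Fin 2 → ZMod 2) j ≠ 1 →
      N i j = 0 := hN
    have m1 : M 0 1 = 0 := hM' 0 1 (by decide)
    have m2 : M 1 0 = 0 := hM' 1 0 (by decide)
    have n1 : N 0 0 = 0 := hN' 0 0 (by decide)
    have n2 : N 1 1 = 0 := hN' 1 1 (by decide)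
    obtain ⟨h1, h2, h3, h4⟩ := h
    rw [Matrix.add_apply] at h1 h3 h4
    rw [Matrix.add_apply, Matrix.add_apply] at h2
    rw [n2, add_zero] at h1
    rw [n1, n2, add_zero, add_zero] at h2
    rw [m1, zero_add] at h3
    rw [m2, zero_add] at h4
    refine ⟨⟨h1, h2, ?_, ?_⟩, ⟨?_, ?_, h3, h4⟩⟩
    · rw [m1]; exact zero_mem _
    · rw [m2]; exact zero_mem _
    · rw [n2]; exact zero_mem _
    · rw [n1, n2, sub_zero]; exact zero_mem _
  bracket_mem M hM N hN := by
    change SuperMatrix.superComm ![0, 1] M N ∈ _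
    rw [superComm_fin_two]
    obtain ⟨h1, h2, h3, h4⟩ := hM
    obtain ⟨g1, g2, g3, g4⟩ := hN
    obtain ⟨a, ha⟩ := Submodule.mem_span_singleton.1 h2
    obtain ⟨b, hb⟩ := Submodule.mem_span_singleton.1 h3
    obtain ⟨d, hd⟩ := Submodule.mem_span_singleton.1 h4
    obtain ⟨a', ha'⟩ := Submodule.mem_span_singleton.1 g2
    obtain ⟨b', hb'⟩ := Submodule.mem_span_singleton.1 g3
    obtain ⟨d', hd'⟩ := Submodule.mem_span_singleton.1 g4
    replace ha := eq_add_of_sub_eq ha.symm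
    replace ha' := eq_add_of_sub_eq ha'.symm
    -- The two diagonal entries of the bracket agree: constant shifts drop out of commutators, and
    -- the anticommutators of constant off-diagonal entries coincide.
    refine ⟨?_, Submodule.mem_span_singleton.2 ⟨0, ?_⟩,
      Submodule.mem_span_singleton.2 ⟨b' * a - a' * b, ?_⟩,
      Submodule.mem_span_singleton.2 ⟨d * a' - d' * a, ?_⟩⟩
    · refine add_mem (commutator_mem_glRange h1 g1) (add_mem ?_ ?_)
      · rw [← hd, ← hb', smul_mul_smul_comm, one_mul]
        exact Submodule.smul_mem _ _ (one_mem_glRange c)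
      · rw [← hd', ← hb, smul_mul_smul_comm, one_mul]
        exact Submodule.smul_mem _ _ (one_mem_glRange c)
    all_goals
      simp only [Matrix.of_apply, Matrix.cons_val, ← hb, ← hd, ← hb', ← hd', ha, ha', add_mul,
        mul_add, smul_mul_assoc, mul_smul_comm, one_mul, mul_one]
      module

theorem J_mem_glRange (c : ℂ) (i : Fin 8) : PolyEnd.J c i ∈ glRange c :=
  Submodule.mem_sup_left ⟨slBasis i, L_slBasis c i⟩

theorem s_zero_le (n : ℕ) : (s n 0).toSubmodule ≤ (glSub n).toSubmodule := by
  refine LieSuperalgebra.lieSpan_le ?_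
  rintro _ (((⟨i, rfl⟩ | rfl) | ⟨a, b, hab, rfl⟩) | ⟨a, b, hab, rfl⟩)
  · refine ⟨J_mem_glRange n i, ?_, ?_, ?_⟩ <;> simp [T]
  · refine ⟨Submodule.smul_mem _ _ (one_mem_glRange n), ?_, ?_, ?_⟩ <;> simp [J]
  · obtain ⟨rfl, rfl⟩ : a = 0 ∧ b = 0 := by omega
    refine ⟨zero_mem _, ?_, ?_, ?_⟩ <;>
      simp [Qminus, q, Submodule.mem_span_singleton_self]
  · obtain ⟨rfl, rfl⟩ : a = 0 ∧ b = 0 := by omega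
    refine ⟨zero_mem _, ?_, ?_, ?_⟩ <;>
      simp [Qplus, qbar, Submodule.mem_span_singleton_self]

theorem finiteDimensional_s_zero (n : ℕ) : FiniteDimensional ℂ (s n 0).toSubmodule := by
  have hV : FiniteDimensional ℂ (glRange n) := by unfold glRange; infer_instance
  have h1 : ℂ ∙ (1 : PolyEnd) ≤ glRange n := le_sup_right
  have key : ∀ M ∈ (s n 0).toSubmodule, ∀ i j, M i j ∈ glRange n := by
    intro M hM i j
    obtain ⟨h11, h, h01, h10⟩ := s_zero_le n hM
    fin_cases i <;> fin_cases j
    · simpa using add_mem (h1 h) h11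
    · exact h1 h01
    · exact h1 h10
    · exact h11
  -- All entries lie in one finite-dimensional space, so the matrices lie in the sum of its four
  -- copies.
  refine Submodule.finiteDimensional_of_le
    (S₂ := ⨆ i, ⨆ j, (glRange n).map (Matrix.singleLinearMap ℂ (i : Fin 2) (j : Fin 2)))
    fun M hM => ?_
  rw [Matrix.matrix_eq_sum_single M]
  exact sum_mem fun i _ => sum_mem fun j _ => Submodule.mem_iSup_of_mem i <|
    Submodule.mem_iSup_of_mem j ⟨M i j, key M hM i j, rfl⟩

/-! ### The case `Δ ≥ 2` -/

theorem dx_pow_mul_x (m : ℕ) : dx ^ m * x = x * dx ^ m + m • dx ^ (m - 1) := by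
  induction m with
  | zero => simp
  | succ m ih =>
    rw [pow_succ', mul_assoc, ih, mul_add, ← mul_assoc, dx_mul_x, mul_smul_comm, ← pow_succ']
    rcases m with _ | m
    · simp
    · simp only [add_tsub_cancel_right, add_mul, mul_assoc, one_mul, ← pow_succ', succ_nsmul]
      abel

/-- Applying an operator to `x^l` and taking the constant term gives functionals dual, up to
factorials, to the powers of `∂x`; this yields their independence. -/
theorem dx_pow_X_pow (m l : ℕ) :
    constantCoeff ((dx ^ m) (X 0 ^ l)) = if m = l then (m.factorial : ℂ) else 0 := by
  induction m generalizing l with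
  | zero => rcases l with _ | l <;> simp
  | succ m ih =>
    rw [pow_succ, Module.End.mul_apply]
    have h : dx (X 0 ^ l) = (l : ℂ) • X 0 ^ (l - 1) := by
      simp [dx, Derivation.leibniz_pow, Algebra.smul_def]
    rw [h, map_smul, constantCoeff_smul, ih]
    rcases l with _ | l
    · simp
    · by_cases hml : m = l
      · subst hml; simp [Nat.factorial_succ]
      · simp [hml]

theorem linearIndependent_dx_pow : LinearIndependent ℂ fun m : ℕ => dx ^ m := by
  rw [linearIndependent_iff']
  intro S g hg l hl
  have h := congrArg (fun A : PolyEnd => constantCoeff (A (X 0 ^ l))) hg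
  simp only [LinearMap.sum_apply, LinearMap.smul_apply, map_sum, constantCoeff_smul, dx_pow_X_pow,
    LinearMap.zero_apply, map_zero] at h
  simpa [hl, Nat.factorial_ne_zero] using h

/-- The diagonal matrix with both entries `A`. -/
def diag (A : PolyEnd) : MatOp := !![A, 0; 0, A]

theorem diag_dx_pow_mem {n Δ : ℕ} (hΔ : 2 ≤ Δ) (k : ℕ) :
    diag (dx ^ (Δ + k * (Δ - 1))) ∈ (s n Δ).toSubmodule := by
  have hg : generators n Δ ⊆ (s n Δ).toSubmodule := matOpSuper.subset_lieSpan _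
  have hm : ∀ a b, a + b ≤ Δ → Qminus a b ∈ (s n Δ).toSubmodule :=
    fun a b h => hg (.inl (.inr ⟨a, b, h, rfl⟩))
  have hp : Qplus n Δ Δ 0 ∈ (s n Δ).toSubmodule := hg (.inr ⟨Δ, 0, le_rfl, rfl⟩)
  have hp' : Qplus n Δ Δ 0 = !![0, dx ^ Δ; 0, 0] := by simp [Qplus, qbar]
  have hb : ∀ M ∈ (s n Δ).toSubmodule, ∀ N ∈ (s n Δ).toSubmodule,
      SuperMatrix.superComm ![0, 1] M N ∈ (s n Δ).toSubmodule := (s n Δ).bracket_mem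
  induction k with
  | zero =>
    -- The anticommutator of `∂x^Δ σ⁺` and `σ⁻` is the starting element.
    have h := hb _ hp _ (hm 0 0 (by omega))
    rw [hp', superComm_fin_two] at h
    simpa [Qminus, q, diag] using h
  | succ k ih =>
    -- This bracket is `diag(∂x^Δ x, x ∂x^Δ)`. Its entries differ by a multiple of `∂x^(Δ-1)`, which
    -- commutes with `∂x^m`, so both diagonal entries of the next commutator equal `m ∂x^(m+Δ-1)`.
    have h := hb _ hp _ (hm 1 0 (by omega))
    rw [hp', superComm_fin_two] at h
    have h' := hb _ ih _ h
    have hk : Δ + (k + 1) * (Δ - 1) = Δ + k * (Δ - 1) + Δ - 1 := by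
      obtain ⟨e, rfl⟩ := Nat.exists_eq_add_of_le' (by omega : 1 ≤ Δ)
      simp only [Nat.add_sub_cancel, add_mul, one_mul]
      omega
    have hm0 : Δ + k * (Δ - 1) ≠ 0 := by omega
    generalize Δ + k * (Δ - 1) = m at *
    have e2 : dx ^ m * (x * dx ^ Δ) - x * dx ^ Δ * dx ^ m = (m : ℂ) • dx ^ (m + Δ - 1) := by
      rw [← mul_assoc, dx_pow_mul_x, add_mul, mul_assoc, mul_assoc, ← pow_add, ← pow_add,
        add_comm Δ m, add_sub_cancel_left, smul_mul_assoc, ← pow_add, Nat.cast_smul_eq_nsmul]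
      congr 2
      omega
    have e1 : dx ^ m * (dx ^ Δ * x) - dx ^ Δ * x * dx ^ m = (m : ℂ) • dx ^ (m + Δ - 1) := by
      rw [← e2, dx_pow_mul_x Δ, mul_add, add_mul, mul_smul_comm, smul_mul_assoc, ← pow_add,
        ← pow_add, add_comm m (Δ - 1), add_sub_add_right_eq_sub]
    have e : SuperMatrix.superComm ![0, 1] (diag (dx ^ m)) !![dx ^ Δ * x, 0; 0, x * dx ^ Δ] =
        (m : ℂ) • diag (dx ^ (m + Δ - 1)) := by
      rw [superComm_fin_two]
      refine Matrix.ext fun a b => ?_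
      fin_cases a <;> fin_cases b <;> simp [diag, e1, e2]
    have h2 : SuperMatrix.superComm ![0, 1] (diag (dx ^ m)) !![dx ^ Δ * x, 0; 0, x * dx ^ Δ] ∈
        (s n Δ).toSubmodule := by
      simpa [Qminus, q] using h'
    rw [e] at h2
    rw [hk]
    exact (Submodule.smul_mem_iff _ (by exact_mod_cast hm0)).1 h2

theorem not_finiteDimensional_s {n Δ : ℕ} (hΔ : 2 ≤ Δ) :
    ¬ FiniteDimensional ℂ (s n Δ).toSubmodule := by
  intro hfd
  have hinj : Function.Injective fun k : ℕ => Δ + k * (Δ - 1) := fun a b h =>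
    Nat.eq_of_mul_eq_mul_right (by omega : 0 < Δ - 1) (Nat.add_left_cancel h)
  let v : ℕ → (s n Δ).toSubmodule := fun k => ⟨_, diag_dx_pow_mem hΔ k⟩
  have hv : LinearIndependent ℂ v := by
    -- The upper left entry suffices: it sends the family to distinct powers of `∂x`, the exponents
    -- being distinct because `Δ - 1 > 0`.
    refine LinearIndependent.of_comp
      ((Matrix.entryLinearMap ℂ PolyEnd 0 0).comp (s n Δ).toSubmodule.subtype) ?_
    exact linearIndependent_dx_pow.comp _ hinj
  exact not_finite_iff_infinite.2 inferInstance hv.finite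

/-! ### The Lie algebra `sl₃ ⊕ sl₂` -/

theorem mem_sl_iff {m : ℕ} (A : Matrix (Fin m) (Fin m) ℂ) :
    A ∈ LieAlgebra.SpecialLinear.sl (Fin m) ℂ ↔ A.trace = 0 := Iff.rfl

/-- The action of `gl₃ ⊕ gl₂`. -/
def tensorRep (c : ℂ) : Matrix (Fin 3) (Fin 3) ℂ × Matrix (Fin 2) (Fin 2) ℂ →ₗ[ℂ] MatOp where
  toFun p := !![L c p.1 + p.2 0 0 • (1 : PolyEnd), p.2 0 1 • (1 : PolyEnd);
    p.2 1 0 • (1 : PolyEnd), L c p.1 + p.2 1 1 • (1 : PolyEnd)]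
  map_add' p q := by
    refine Matrix.ext fun a b => ?_
    fin_cases a <;> fin_cases b <;> simp [add_smul, add_add_add_comm]
  map_smul' u p := by
    refine Matrix.ext fun a b => ?_
    fin_cases a <;> fin_cases b <;> simp [mul_smul]

theorem tensorRep_apply (c : ℂ) (A : Matrix (Fin 3) (Fin 3) ℂ) (B : Matrix (Fin 2) (Fin 2) ℂ) :
    tensorRep c (A, B) = !![L c A + B 0 0 • (1 : PolyEnd), B 0 1 • (1 : PolyEnd);
      B 1 0 • (1 : PolyEnd), L c A + B 1 1 • (1 : PolyEnd)] := rfl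

/-- The `gl₃` operators act by the same operator on both components, so they commute with constant
`2 × 2` matrices. -/
theorem tensorRep_commutator (c : ℂ) (A A' : Matrix (Fin 3) (Fin 3) ℂ)
    (B B' : Matrix (Fin 2) (Fin 2) ℂ) :
    tensorRep c (A * A' - A' * A, B * B' - B' * B) =
      tensorRep c (A, B) * tensorRep c (A', B') - tensorRep c (A', B') * tensorRep c (A, B) := by
  refine Matrix.ext fun a b => ?_
  simp only [tensorRep_apply, L_commutator]
  fin_cases a <;> fin_cases b <;>
    simp [Matrix.mul_apply, Fin.sum_univ_two, mul_add, add_mul] <;> module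

/-- Subtracting the diagonal entries eliminates `L c A`, and trace zero then kills `B`. Trace zero
also excludes a scalar `A`, so, unlike for `gl(3, 1)`, the value `c = 0` is allowed. -/
theorem eq_zero_of_tensorRep_eq_zero {c : ℂ} {A : Matrix (Fin 3) (Fin 3) ℂ}
    {B : Matrix (Fin 2) (Fin 2) ℂ} (hA : A.trace = 0) (hB : B.trace = 0)
    (h : tensorRep c (A, B) = 0) : A = 0 ∧ B = 0 := by
  rw [tensorRep_apply] at h
  have h00 := congrFun (congrFun h 0) 0
  have h01 := congrFun (congrFun h 0) 1
  have h10 := congrFun (congrFun h 1) 0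
  have h11 := congrFun (congrFun h 1) 1
  simp only [Matrix.of_apply, Matrix.cons_val, Matrix.zero_apply] at h00 h01 h10 h11
  have hone : (1 : PolyEnd) ≠ 0 := one_ne_zero
  replace h01 := (smul_eq_zero.1 h01).resolve_right hone
  replace h10 := (smul_eq_zero.1 h10).resolve_right hone
  have hd : (B 0 0 - B 1 1) • (1 : PolyEnd) =
      L c A + B 0 0 • (1 : PolyEnd) - (L c A + B 1 1 • (1 : PolyEnd)) := by module
  rw [h00, h11, sub_zero] at hd
  replace hd := (smul_eq_zero.1 hd).resolve_right hone
  rw [Matrix.trace_fin_two] at hB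
  have b0 : B 0 0 = 0 := by linear_combination (hd + hB) / 2
  have b1 : B 1 1 = 0 := by linear_combination (hB - hd) / 2
  rw [b0, zero_smul, add_zero] at h00
  obtain ⟨h1, -⟩ := L_eq_zero h00
  have h2 : A 0 0 = 0 := by
    rw [h1] at hA
    simpa using hA
  rw [h2, zero_smul] at h1
  refine ⟨h1, Matrix.ext fun i j => ?_⟩
  fin_cases i <;> fin_cases j <;> assumption

/-- The representation of `sl₃ ⊕ sl₂` by matrices of differential operators. -/
def slRep (c : ℂ) : (LieAlgebra.SpecialLinear.sl (Fin 3) ℂ × LieAlgebra.SpecialLinear.sl (Fin 2) ℂ)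
    →ₗ⁅ℂ⁆ MatOp where
  toLinearMap := (tensorRep c).comp
    ((LieAlgebra.SpecialLinear.sl (Fin 3) ℂ).toSubmodule.subtype.prodMap
      (LieAlgebra.SpecialLinear.sl (Fin 2) ℂ).toSubmodule.subtype)
  map_lie' {p q} := tensorRep_commutator c p.1 q.1 p.2 q.2

theorem slRep_apply (c : ℂ)
    (p : LieAlgebra.SpecialLinear.sl (Fin 3) ℂ × LieAlgebra.SpecialLinear.sl (Fin 2) ℂ) :
    slRep c p = tensorRep c (p.1.1, p.2.1) := rfl

theorem slRep_injective (c : ℂ) : Function.Injective (slRep c) := by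
  rw [injective_iff_map_eq_zero]
  rintro ⟨⟨A, hA⟩, ⟨B, hB⟩⟩ h
  obtain ⟨h1, h2⟩ := eq_zero_of_tensorRep_eq_zero hA hB h
  exact Prod.ext (Subtype.ext h1) (Subtype.ext h2)

theorem slRep_eq (n : ℕ)
    (p : LieAlgebra.SpecialLinear.sl (Fin 3) ℂ × LieAlgebra.SpecialLinear.sl (Fin 2) ℂ) :
    slRep n p = ∑ i, slCoord p.1.1 i • T n 0 i + (p.2.1 0 0 • sigma3 + p.2.1 1 0 • Qminus 0 0 +
      p.2.1 0 1 • Qplus n 0 0 0) := by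
  have hA : p.1.1.trace = 0 := (mem_sl_iff _).1 p.1.2
  have hB : p.2.1.trace = 0 := (mem_sl_iff _).1 p.2.2
  rw [Matrix.trace_fin_two] at hB
  rw [slRep_apply, tensorRep_apply, L_eq, hA, eq_neg_of_add_eq_zero_right hB]
  refine Matrix.ext fun a b => ?_
  fin_cases a <;> fin_cases b <;>
    simp [T, sigma3, Qminus, Qplus, q, qbar, Matrix.sum_apply]
  module

theorem range_slRep (n : ℕ) : (slRep n).range = sZeroLie n := by
  apply le_antisymm
  · rintro _ ⟨p, rfl⟩
    have hg : Set.range (T n 0) ∪ {sigma3, Qminus 0 0, Qplus n 0 0 0} ⊆ (sZeroLie n : Set MatOp) :=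
      LieSubalgebra.subset_lieSpan
    change slRep n p ∈ (sZeroLie n).toSubmodule
    rw [slRep_eq]
    refine add_mem (sum_mem fun i _ => Submodule.smul_mem _ _ (hg (.inl ⟨i, rfl⟩)))
      (add_mem (add_mem (Submodule.smul_mem _ _ ?_) (Submodule.smul_mem _ _ ?_))
        (Submodule.smul_mem _ _ ?_))
    · exact hg (by simp)
    · exact hg (by simp)
    · exact hg (by simp)
  · refine LieSubalgebra.lieSpan_le.2 ?_
    rintro _ (⟨i, rfl⟩ | rfl | rfl | rfl)
    · refine ⟨(⟨slBasis i, (mem_sl_iff _).2 (trace_slBasis i)⟩, 0), ?_⟩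
      change tensorRep n (slBasis i, 0) = _
      rw [tensorRep_apply, L_slBasis]
      simp [T]
    · refine ⟨(0, ⟨!![1, 0; 0, -1], (mem_sl_iff _).2
        (by simp [Matrix.trace_fin_two])⟩), ?_⟩
      change tensorRep n (0, !![1, 0; 0, -1]) = _
      rw [tensorRep_apply]
      refine Matrix.ext fun a b => ?_
      fin_cases a <;> fin_cases b <;> simp [sigma3]
      module
    · refine ⟨(0, ⟨!![0, 0; 1, 0], (mem_sl_iff _).2
        (by simp [Matrix.trace_fin_two])⟩), ?_⟩
      change tensorRep n (0, !![0, 0; 1, 0]) = _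
      rw [tensorRep_apply]
      simp [Qminus, q]
    · refine ⟨(0, ⟨!![0, 1; 0, 0], (mem_sl_iff _).2
        (by simp [Matrix.trace_fin_two])⟩), ?_⟩
      change tensorRep n (0, !![0, 1; 0, 0]) = _
      rw [tensorRep_apply]
      simp [Qplus, qbar]

theorem nonempty_sZeroLie_equiv (n : ℕ) :
    Nonempty (sZeroLie n ≃ₗ⁅ℂ⁆
      (LieAlgebra.SpecialLinear.sl (Fin 3) ℂ × LieAlgebra.SpecialLinear.sl (Fin 2) ℂ)) :=
  range_slRep n ▸ ⟨(LieEquiv.ofInjective (slRep n) (slRep_injective n)).symm⟩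

end Triangular

end

theorem mainTheorem9 :
    (∀ n Δ : ℕ, Δ ≤ n →
      (FiniteDimensional ℂ (Triangular.s n Δ).toSubmodule ↔ Δ ≤ 1)) ∧
    (∀ n : ℕ, 1 ≤ n →
      Nonempty (LieSuperalgebra.Iso (Triangular.s n 1).toLieSuperalgebra
        (spl 3 1).toLieSuperalgebra)) ∧
    (∀ n : ℕ,
      Nonempty (Triangular.sZeroLie n ≃ₗ⁅ℂ⁆
        (LieAlgebra.SpecialLinear.sl (Fin 3) ℂ × LieAlgebra.SpecialLinear.sl (Fin 2) ℂ))) := by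
  refine ⟨fun n Δ _ => ⟨fun h => ?_, fun h => ?_⟩, fun n hn => Triangular.nonempty_iso_spl hn,
    Triangular.nonempty_sZeroLie_equiv⟩
  · by_contra hΔ
    exact Triangular.not_finiteDimensional_s (by omega) h
  · interval_cases Δ
    · exact Triangular.finiteDimensional_s_zero n
    · exact Triangular.finiteDimensional_s_one n
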